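/- Let $N\ge 0$ be an integer, and let $p_i,c_i,\xi_{i0}\in\mathbb{C}$ ($i=1,\dots,2N$) be constants with $p_i\neq 0$ for all $i$, $p_i+p_j\neq 0$ for all $i\ne j$, and $$c_i=-c_{2N+1-i},\qquad p_i^2-p_i\,p_{2N+1-i}+p_{2N+1-i}^2=0\qquad(i=1,\dots,2N).$$ For real variables $x_1,x_{-1}$ put $$\xi_i=p_ix_1+p_i^{-1}x_{-1}+\xi_{i0},\qquad \mathrm{pf}(i,j)=\delta_{j,2N+1-i}\,c_i+\frac{p_i-p_j}{p_i+p_j}\,e^{\xi_i+\xi_j},$$ and let $\tau(x_1,x_{-1})=\mathrm{pf}(1,2,\dots,2N)$ be the Pfaffian with these entries, that is, $$\tau=\sum_{\pi}\operatorname{sgn}(\pi)\,\mathrm{pf}(i_1,j_1)\cdots\mathrm{pf}(i_N,j_N),$$ the sum being over all permutations $\pi=\begin{pmatrix}1&2&\cdots&2N-1&2N\\ i_1&j_1&\cdots&i_N&j_N\end{pmatrix}$ of $\{1,\dots,2N\}$ with $i_1<i_2<\dots<i_N$ and $i_k<j_k$ for every $k$ (for $N=0$, $\tau=1$). Then $\tau$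 is a smooth function of $(x_1,x_{-1})\in\mathbb{R}^2$ with values in $\mathbb{C}$, and it satisfies at every point the bilinear equation $$\left(D_{x_{-1}}D_{x_1}^3-3D_{x_1}^2\right)\tau\cdot\tau=0 ,$$ where $D$ is the Hirota operator, $$D_{x_{-1}}^mD_{x_1}^n\,a\cdot b=\left(\partial_{x_{-1}}-\partial_{x_{-1}'}\right)^m\left(\partial_{x_1}-\partial_{x_1'}\right)^n a(x_1,x_{-1})\,b(x_1',x_{-1}')\Big|_{x_1'=x_1,\;x_{-1}'=x_{-1}} .$$ -/

import Mathlib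

open scoped ContDiff

namespace BKPSoliton

/-- The position `2k + 1` (counted from `1`) of `{1, …, 2N}`: where `i_k` stands in the
sequence `i_1, j_1, …, i_N, j_N`. -/
def fstPos {N : ℕ} (k : Fin N) : Fin (2 * N) := ⟨2 * k.val, by omega⟩

/-- The position `2k + 2` (counted from `1`) of `{1, …, 2N}`: where `j_k` stands in the
sequence `i_1, j_1, …, i_N, j_N`. -/
def sndPos {N : ℕ} (k : Fin N) : Fin (2 * N) := ⟨2 * k.val + 1, by omega⟩

/-- The permutation `π`, written `1 ↦ i_1, 2 ↦ j_1, 3 ↦ i_2, 4 ↦ j_2, …`, satisfies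
`i_1 < i_2 < ⋯ < i_N` and `i_1 < j_1, …, i_N < j_N`. -/
def IsPairing {N : ℕ} (π : Equiv.Perm (Fin (2 * N))) : Prop :=
  (∀ k l : Fin N, k < l → π (fstPos k) < π (fstPos l)) ∧
    ∀ k : Fin N, π (fstPos k) < π (sndPos k)

instance {N : ℕ} : DecidablePred (IsPairing (N := N)) := fun π => by
  unfold IsPairing; infer_instance

/-- The Pfaffian `pf(1, 2, …, 2N) = ∑_π sgn(π) a_{i_1 j_1} ⋯ a_{i_N j_N}` of the array
`a_{i j} = pf(i, j)`. -/
def pf {N : ℕ} (a : Fin (2 * N) → Fin (2 * N) → ℂ) : ℂ :=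
  ∑ π : Equiv.Perm (Fin (2 * N)) with IsPairing π,
    ((Equiv.Perm.sign π : ℤ) : ℂ) * ∏ k : Fin N, a (π (fstPos k)) (π (sndPos k))

/-- `∂_{x_1} - ∂_{x_1'}` on functions of `(x_1, x_{-1}, x_1', x_{-1}')`. -/
noncomputable def diffOne (F : ℝ → ℝ → ℝ → ℝ → ℂ) : ℝ → ℝ → ℝ → ℝ → ℂ :=
  fun x y x' y' => deriv (fun s => F s y x' y') x - deriv (fun s => F x y s y') x'

/-- `∂_{x_{-1}} - ∂_{x_{-1}'}` on functions of `(x_1, x_{-1}, x_1', x_{-1}')`. -/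
noncomputable def diffNegOne (F : ℝ → ℝ → ℝ → ℝ → ℂ) : ℝ → ℝ → ℝ → ℝ → ℂ :=
  fun x y x' y' => deriv (fun s => F x s x' y') y - deriv (fun s => F x y x' s) y'

/-- The Hirota derivative `D_{x_{-1}}^m D_{x_1}^n a · b` of two functions of `(x_1, x_{-1})`:
`(∂_{x_{-1}} - ∂_{x_{-1}'})^m (∂_{x_1} - ∂_{x_1'})^n a(x_1, x_{-1}) b(x_1', x_{-1}')`
evaluated at `x_1' = x_1`, `x_{-1}' = x_{-1}`. -/
noncomputable def hirota (m n : ℕ) (a b : ℝ → ℝ → ℂ) (x y : ℝ) : ℂ :=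
  (diffNegOne^[m] (diffOne^[n] fun x y x' y' => a x y * b x' y')) x y x y

/-- The phase `ξ_i = p_i x_1 + p_i⁻¹ x_{-1} + ξ_{i0}`. -/
noncomputable def phase {N : ℕ} (p ξ₀ : Fin (2 * N) → ℂ) (i : Fin (2 * N)) (x y : ℝ) : ℂ :=
  p i * x + (p i)⁻¹ * y + ξ₀ i

/-- The entry `pf(i, j) = δ_{j, 2N+1-i} c_i + (p_i - p_j) / (p_i + p_j) e^{ξ_i + ξ_j}`.
The index `2N + 1 - i` (indices from `1`) is `Fin.rev i`. -/
noncomputable def entry {N : ℕ} (p c ξ₀ : Fin (2 * N) → ℂ) (x y : ℝ) (i j : Fin (2 * N)) : ℂ :=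
  (if j = Fin.rev i then c i else 0) +
    (p i - p j) / (p i + p j) * Complex.exp (phase p ξ₀ i x y + phase p ξ₀ j x y)

/-- The `N`-soliton function `τ(x_1, x_{-1}) = pf(1, 2, …, 2N)`. -/
noncomputable def tau {N : ℕ} (p c ξ₀ : Fin (2 * N) → ℂ) (x y : ℝ) : ℂ :=
  pf (entry p c ξ₀ x y)

end BKPSoliton

/-! Let `A` be the matrix of entries, `v_n = (p_i ^ n e^{ξ_i})`, and write `b m n` for the bracket
`v_m ⬝ A⁻¹ v_n`. Differentiating an entry cancels the denominator `p_i + p_j`, so `∂A = v_1 v_0ᵀ -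
v_0 v_1ᵀ` along `x_1` and `∂A = v_0 v_{-1}ᵀ - v_{-1} v_0ᵀ` along `x_{-1}`. Where `det A ≠ 0`, the
formula `∂ pf A = (1/2) tr(A⁻¹ ∂A) pf A` (`hasDerivAt_pf`) makes both logarithmic derivatives of `τ`
brackets, and the derivative of a bracket is a polynomial in brackets. All derivatives in the
equation thus become `τ` times polynomials in brackets.

The remaining input is the reduction `p_i ^ 3 + p_{2N+1-i} ^ 3 = 0`. It kills the contribution of
the `c_i` to `QA + AQ`, `Q = diag(p_i ^ 3)`, which is then the derivative of `A` under an additional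
flow `p_i ^ 3 x_3`. Its trace against `A⁻¹` is `2 tr Q = 0`, whence `b 0 3 = 2 b 1 2`
(`bracket_zero_three`). The bilinear expression is a combination of this relation and its
`x_{-1}`-derivative (`bilinearForm_tau_of_det_ne_zero`).

Where `det A = 0` a continuity argument takes over (`bilinearForm_tau`): it rests on the fact that a
singular skew-symmetric matrix has Pfaffian `0`. This and the derivative formula come from `pf (B A
Bᵀ) = det B * pf A`, which is easiest for the sum over all permutations (`pfSum`). -/

namespace BKPSoliton

open Matrix

variable {N : ℕ}

/-! ### The Pfaffian as a sum over all permutations -/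

/-- The positions `{1, …, 2N}` arranged in consecutive pairs. -/
def posEquiv (N : ℕ) : Fin N × Fin 2 ≃ Fin (2 * N) where
  toFun q := ⟨2 * q.1.val + q.2.val, by omega⟩
  invFun i := (⟨i.val / 2, by omega⟩, ⟨i.val % 2, by omega⟩)
  left_inv q := by
    ext
    · simp only; omega
    · simp only; omega
  right_inv i := by
    ext
    simp only; omega

lemma posEquiv_zero (k : Fin N) : posEquiv N (k, 0) = fstPos k := rfl

lemma posEquiv_one (k : Fin N) : posEquiv N (k, 1) = sndPos k := rfl

lemma prod_pos {M : Type*} [CommMonoid M] (g : Fin (2 * N) → M) :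
    ∏ i, g i = ∏ k : Fin N, g (fstPos k) * g (sndPos k) := by
  rw [← (posEquiv N).prod_comp, Fintype.prod_prod_type]
  simp [Fin.prod_univ_two, posEquiv_zero, posEquiv_one]

/-- Functions on the positions as functions on consecutive pairs of positions. -/
def pairFunEquiv (N : ℕ) (α : Type*) : (Fin (2 * N) → α) ≃ (Fin N → α × α) :=
  ((posEquiv N).symm.arrowCongr (Equiv.refl α)).trans
    ((Equiv.curry _ _ _).trans (Equiv.piCongrRight fun _ => finTwoArrowEquiv α))

lemma pairFunEquiv_apply {α : Type*} (g : Fin (2 * N) → α) (k : Fin N) :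
    pairFunEquiv N α g k = (g (fstPos k), g (sndPos k)) := rfl

/-- The signed sum of `∏ A (σ i_k) (σ j_k)` over all permutations, which is `2 ^ N * N !` times the
Pfaffian of a skew-symmetric matrix. -/
def pfSum (A : Matrix (Fin (2 * N)) (Fin (2 * N)) ℂ) : ℂ :=
  ∑ σ : Equiv.Perm (Fin (2 * N)),
    ((Equiv.Perm.sign σ : ℤ) : ℂ) * ∏ k : Fin N, A (σ (fstPos k)) (σ (sndPos k))

/-- Expanding every entry gives a sum over index choices `g`, weighted by the determinant of the
columns of `B` selected by `g`. A repeated column gives `0`; a permutation gives `sign g * det B`.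
-/
lemma pfSum_mul_mul_transpose (A B : Matrix (Fin (2 * N)) (Fin (2 * N)) ℂ) :
    pfSum (B * A * Bᵀ) = B.det * pfSum A := by
  have expand (σ : Equiv.Perm (Fin (2 * N))) :
      ∏ k : Fin N, (B * A * Bᵀ) (σ (fstPos k)) (σ (sndPos k)) =
        ∑ g : Fin (2 * N) → Fin (2 * N),
          (∏ k : Fin N, A (g (fstPos k)) (g (sndPos k))) * ∏ i, B (σ i) (g i) := by
    have entry_eq (i j : Fin (2 * N)) : (B * A * Bᵀ) i j =
        ∑ q : Fin (2 * N) × Fin (2 * N), A q.1 q.2 * (B i q.1 * B j q.2) := by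
      rw [Fintype.sum_prod_type_right, Matrix.mul_apply]
      refine Finset.sum_congr rfl fun b _ => ?_
      rw [Matrix.mul_apply, Finset.sum_mul]
      refine Finset.sum_congr rfl fun a _ => ?_
      rw [Matrix.transpose_apply]; ring
    simp_rw [entry_eq]
    rw [Finset.prod_univ_sum, Fintype.piFinset_univ, ← (pairFunEquiv N _).sum_comp]
    refine Finset.sum_congr rfl fun g _ => ?_
    rw [prod_pos, ← Finset.prod_mul_distrib]
    simp [pairFunEquiv_apply]
  have det_eq (g : Fin (2 * N) → Fin (2 * N)) :
      ∑ σ : Equiv.Perm (Fin (2 * N)), ((Equiv.Perm.sign σ : ℤ) : ℂ) * ∏ i, B (σ i) (g i) =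
        (B.submatrix id g).det := by
    rw [Matrix.det_apply']; rfl
  unfold pfSum
  simp_rw [expand, Finset.mul_sum]
  rw [Finset.sum_comm]
  have step (g : Fin (2 * N) → Fin (2 * N)) :
      ∑ σ : Equiv.Perm (Fin (2 * N)), ((Equiv.Perm.sign σ : ℤ) : ℂ) *
        ((∏ k : Fin N, A (g (fstPos k)) (g (sndPos k))) * ∏ i, B (σ i) (g i)) =
      (∏ k : Fin N, A (g (fstPos k)) (g (sndPos k))) * (B.submatrix id g).det := by
    rw [← det_eq, Finset.mul_sum]
    exact Finset.sum_congr rfl fun σ _ => by ring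
  simp_rw [step]
  symm
  refine Finset.sum_of_injOn (fun σ : Equiv.Perm (Fin (2 * N)) => (σ : Fin (2 * N) → Fin (2 * N)))
    (fun σ _ τ _ h => Equiv.coe_fn_injective h) (fun _ _ => Finset.mem_coe.2 (Finset.mem_univ _))
    ?_ ?_
  · intro g _ hg
    have hg' : ¬ Function.Injective g := fun h => hg
      ⟨Equiv.ofBijective g (Finite.injective_iff_bijective.1 h), by simp, rfl⟩
    rw [Function.Injective] at hg'
    push Not at hg'
    obtain ⟨i, j, hij, hne⟩ := hg'
    rw [Matrix.det_zero_of_column_eq hne (fun k => by simp [hij]), mul_zero]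
  · intro σ _
    rw [Matrix.det_permute']
    ring

/-- Putting a null vector `v` with `v i ≠ 0` in row `i` of the identity gives `B` with `det B = v
i`. Row and column `i` of `B A Bᵀ` vanish, and every term of its `pfSum` contains one such entry. -/
lemma pfSum_eq_zero_of_det_eq_zero {A : Matrix (Fin (2 * N)) (Fin (2 * N)) ℂ} (hA : Aᵀ = -A)
    (h : A.det = 0) : pfSum A = 0 := by
  obtain ⟨v, hv, hvA⟩ := Matrix.exists_vecMul_eq_zero_iff.2 h
  obtain ⟨i, hi⟩ := Function.ne_iff.1 hv
  set B := (1 : Matrix (Fin (2 * N)) (Fin (2 * N)) ℂ).updateRow i v with hB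
  have hdet : B.det = v i := by
    have := Matrix.cramer_transpose_apply (1 : Matrix (Fin (2 * N)) (Fin (2 * N)) ℂ) v i
    rw [hB, ← this]; simp
  have hrow (j) : (B * A * Bᵀ) i j = 0 := by
    rw [Matrix.mul_apply]
    refine Finset.sum_eq_zero fun k _ => ?_
    have : (B * A) i k = (v ᵥ* A) k := by
      simp [hB, Matrix.mul_apply, Matrix.vecMul, dotProduct]
    rw [this, hvA]; simp
  have hcol (j) : (B * A * Bᵀ) j i = 0 := by
    have hskew : (B * A * Bᵀ)ᵀ = -(B * A * Bᵀ) := by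
      simp [Matrix.transpose_mul, hA, Matrix.mul_assoc]
    have := congrFun (congrFun hskew i) j
    rw [Matrix.transpose_apply, Matrix.neg_apply, hrow, neg_zero] at this
    exact this
  have hzero : pfSum (B * A * Bᵀ) = 0 := by
    refine Finset.sum_eq_zero fun σ _ => mul_eq_zero_of_right _ ?_
    obtain ⟨⟨k, e⟩, hk⟩ := (posEquiv N).surjective (σ.symm i)
    refine Finset.prod_eq_zero (Finset.mem_univ k) ?_
    fin_cases e
    · have : σ (fstPos k) = i := by rw [← posEquiv_zero]; simpa [Equiv.eq_symm_apply] using hk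
      rw [this, hrow]
    · have : σ (sndPos k) = i := by rw [← posEquiv_one]; simpa [Equiv.eq_symm_apply] using hk
      rw [this, hcol]
  rw [pfSum_mul_mul_transpose, hdet] at hzero
  exact (mul_eq_zero.1 hzero).resolve_left hi

/-! ### Comparison with the sum over pairings -/

/-- The permutation of the positions which permutes the consecutive pairs by `ρ` after permuting
the `k`-th pair by `ε k`. -/
def blockPerm (q : Equiv.Perm (Fin N) × (Fin N → Equiv.Perm (Fin 2))) :
    Equiv.Perm (Fin (2 * N)) :=
  (posEquiv N).permCongr (Equiv.prodCongrLeft (fun _ => q.1) * Equiv.prodCongrRight q.2)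

lemma blockPerm_posEquiv (q : Equiv.Perm (Fin N) × (Fin N → Equiv.Perm (Fin 2))) (k : Fin N)
    (e : Fin 2) : blockPerm q (posEquiv N (k, e)) = posEquiv N (q.1 k, q.2 k e) := by
  simp [blockPerm, Equiv.permCongr_apply]

/-- Moving whole pairs by `ρ` acts as `ρ` on first and on second positions, so its sign is a square.
-/
lemma sign_blockPerm (q : Equiv.Perm (Fin N) × (Fin N → Equiv.Perm (Fin 2))) :
    Equiv.Perm.sign (blockPerm q) = ∏ k, Equiv.Perm.sign (q.2 k) := by
  rw [blockPerm, Equiv.Perm.sign_permCongr, Equiv.Perm.sign_mul, Equiv.Perm.sign_prodCongrLeft,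
    Equiv.Perm.sign_prodCongrRight, Fin.prod_univ_two, Int.units_mul_self, one_mul]

lemma perm_fin_two_cases (ε : Equiv.Perm (Fin 2)) : ε = 1 ∨ ε = Equiv.swap 0 1 := by
  revert ε; decide

lemma sign_mul_prod_blockPerm {A : Matrix (Fin (2 * N)) (Fin (2 * N)) ℂ} (hA : Aᵀ = -A)
    (π : Equiv.Perm (Fin (2 * N))) (q : Equiv.Perm (Fin N) × (Fin N → Equiv.Perm (Fin 2))) :
    ((Equiv.Perm.sign (π * blockPerm q) : ℤ) : ℂ) *
        ∏ k : Fin N, A ((π * blockPerm q) (fstPos k)) ((π * blockPerm q) (sndPos k)) =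
      ((Equiv.Perm.sign π : ℤ) : ℂ) * ∏ k : Fin N, A (π (fstPos k)) (π (sndPos k)) := by
  have hskew (i j) : A j i = -A i j := congrFun (congrFun hA i) j
  have factor (k : Fin N) :
      A ((π * blockPerm q) (fstPos k)) ((π * blockPerm q) (sndPos k)) =
        ((Equiv.Perm.sign (q.2 k) : ℤ) : ℂ) * A (π (fstPos (q.1 k))) (π (sndPos (q.1 k))) := by
    rw [← posEquiv_zero, ← posEquiv_one, Equiv.Perm.mul_apply, Equiv.Perm.mul_apply,
      blockPerm_posEquiv, blockPerm_posEquiv]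
    rcases perm_fin_two_cases (q.2 k) with h | h
    · simp [h, posEquiv_zero, posEquiv_one]
    · rw [h, Equiv.Perm.sign_swap (by decide), Equiv.swap_apply_left, Equiv.swap_apply_right,
        posEquiv_zero, posEquiv_one, hskew]
      simp
  simp_rw [factor]
  rw [Finset.prod_mul_distrib, Equiv.prod_comp q.1 fun k => A (π (fstPos k)) (π (sndPos k)),
    Equiv.Perm.sign_mul, sign_blockPerm]
  have hsq : ((∏ k, Equiv.Perm.sign (q.2 k) : ℤˣ) : ℤ) *
      ((∏ k, Equiv.Perm.sign (q.2 k) : ℤˣ) : ℤ) = 1 := by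
    rw [← Units.val_mul, Int.units_mul_self, Units.val_one]
  have hsq' := congrArg (Int.cast : ℤ → ℂ) hsq
  push_cast at hsq' ⊢
  linear_combination (((Equiv.Perm.sign π : ℤ) : ℂ) *
    ∏ k : Fin N, A (π (fstPos k)) (π (sndPos k))) * hsq'

/-- The inequalities `i_k < j_k` force equal flips; the increasing sequences of first elements then
have the same range and coincide. -/
lemma pairing_mul_blockPerm_injective {π π' : Equiv.Perm (Fin (2 * N))} (hπ : IsPairing π)
    (hπ' : IsPairing π') {q q' : Equiv.Perm (Fin N) × (Fin N → Equiv.Perm (Fin 2))}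
    (h : π * blockPerm q = π' * blockPerm q') : π = π' ∧ q = q' := by
  have key (k : Fin N) (e : Fin 2) :
      π (posEquiv N (q.1 k, q.2 k e)) = π' (posEquiv N (q'.1 k, q'.2 k e)) := by
    have := congrArg (fun σ : Equiv.Perm (Fin (2 * N)) => σ (posEquiv N (k, e))) h
    simpa [blockPerm_posEquiv] using this
  have ends (k : Fin N) : π (fstPos (q.1 k)) = π' (fstPos (q'.1 k)) ∧
      π (sndPos (q.1 k)) = π' (sndPos (q'.1 k)) := by
    have h0 := key k 0
    have h1 := key k 1
    have hlt := hπ.2 (q.1 k)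
    have hlt' := hπ'.2 (q'.1 k)
    rcases perm_fin_two_cases (q.2 k) with he | he <;>
      rcases perm_fin_two_cases (q'.2 k) with he' | he' <;>
      simp only [he, he', Equiv.Perm.one_apply, Equiv.swap_apply_left, Equiv.swap_apply_right,
        posEquiv_zero, posEquiv_one] at h0 h1
    · exact ⟨h0, h1⟩
    · rw [h0, h1] at hlt; exact absurd hlt hlt'.asymm
    · rw [h0, h1] at hlt; exact absurd hlt hlt'.asymm
    · exact ⟨h1, h0⟩
  have hmono : StrictMono fun k => π (fstPos k) := fun k l hkl => hπ.1 k l hkl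
  have hmono' : StrictMono fun k => π' (fstPos k) := fun k l hkl => hπ'.1 k l hkl
  have hf : (fun k => π (fstPos k)) = fun k => π' (fstPos k) := by
    rw [← StrictMono.range_inj hmono hmono']
    rw [← q.1.surjective.range_comp, ← q'.1.surjective.range_comp (fun k => π' (fstPos k))]
    exact congrArg Set.range (funext fun k => (ends k).1)
  have hρ : q.1 = q'.1 := by
    ext1 k
    refine hmono.injective ?_
    exact (ends k).1.trans (congrFun hf _).symm
  have hs (k : Fin N) : π (sndPos k) = π' (sndPos k) := by
    have := (ends (q.1.symm k)).2
    rw [← hρ, Equiv.apply_symm_apply] at this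
    exact this
  have hππ : π = π' := by
    ext1 i
    obtain ⟨⟨k, e⟩, rfl⟩ := (posEquiv N).surjective i
    fin_cases e
    · exact congrFun hf k
    · exact hs k
  refine ⟨hππ, Prod.ext hρ (funext fun k => Equiv.ext fun e => ?_)⟩
  have := key k e
  rw [hππ, hρ] at this
  simpa using this

/-- Flip each pair into increasing order, then sort the pairs by first element. -/
lemma exists_pairing_mul_blockPerm (σ : Equiv.Perm (Fin (2 * N))) :
    ∃ π : Equiv.Perm (Fin (2 * N)), IsPairing π ∧ ∃ q, π * blockPerm q = σ := by
  have hε (k : Fin N) : ∃ ε : Equiv.Perm (Fin 2),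
      σ (posEquiv N (k, ε 0)) < σ (posEquiv N (k, ε 1)) := by
    rcases lt_or_gt_of_ne (show σ (posEquiv N (k, 0)) ≠ σ (posEquiv N (k, 1)) by simp) with h | h
    · exact ⟨1, h⟩
    · exact ⟨Equiv.swap 0 1, by simpa using h⟩
  choose ε hε using hε
  let f : Fin N → Fin (2 * N) := fun k => σ (posEquiv N (k, ε k 0))
  have hf : Function.Injective f := fun k l hkl => by
    have := (posEquiv N).injective (σ.injective hkl)
    exact congrArg Prod.fst this
  let ρ := Tuple.sort f
  have hmono : StrictMono (f ∘ ρ) :=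
    (Tuple.monotone_sort f).strictMono_of_injective (hf.comp ρ.injective)
  let π := σ * (posEquiv N).permCongr
    (Equiv.prodCongrRight ε * Equiv.prodCongrLeft (fun _ => ρ))
  have hπ (k e) : π (posEquiv N (k, e)) = σ (posEquiv N (ρ k, ε (ρ k) e)) := by
    simp [π, Equiv.permCongr_apply]
  refine ⟨π, ⟨fun k l hkl => ?_, fun k => ?_⟩, (ρ⁻¹, fun k => (ε k)⁻¹), ?_⟩
  · rw [← posEquiv_zero, ← posEquiv_zero, hπ, hπ]
    exact hmono hkl
  · rw [← posEquiv_zero, ← posEquiv_one, hπ, hπ]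
    exact hε _
  · ext1 i
    obtain ⟨⟨k, e⟩, rfl⟩ := (posEquiv N).surjective i
    rw [Equiv.Perm.mul_apply, blockPerm_posEquiv, hπ]
    simp

lemma pfSum_eq_card_mul_pf {A : Matrix (Fin (2 * N)) (Fin (2 * N)) ℂ} (hA : Aᵀ = -A) :
    pfSum A =
      (Fintype.card (Equiv.Perm (Fin N) × (Fin N → Equiv.Perm (Fin 2))) : ℂ) * pf A := by
  have reindex : pfSum A = ∑ x ∈ (Finset.univ.filter
      (IsPairing (N := N))) ×ˢ
        (Finset.univ : Finset (Equiv.Perm (Fin N) × (Fin N → Equiv.Perm (Fin 2)))),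
      ((Equiv.Perm.sign x.1 : ℤ) : ℂ) * ∏ k : Fin N, A (x.1 (fstPos k)) (x.1 (sndPos k)) := by
    symm
    refine Finset.sum_bij (fun x _ => x.1 * blockPerm x.2) (fun _ _ => Finset.mem_univ _)
      (fun x hx y hy h => ?_) (fun σ _ => ?_) (fun x _ => (sign_mul_prod_blockPerm hA _ _).symm)
    · simp only [Finset.mem_product, Finset.mem_filter, Finset.mem_univ, true_and, and_true] at hx hy
      obtain ⟨h1, h2⟩ := pairing_mul_blockPerm_injective hx hy h
      exact Prod.ext h1 h2
    · obtain ⟨π, hπ, q, hq⟩ := exists_pairing_mul_blockPerm σ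
      exact ⟨(π, q), by simpa using hπ, hq⟩
  have hpf : pf A = ∑ π : Equiv.Perm (Fin (2 * N)) with IsPairing π,
      ((Equiv.Perm.sign π : ℤ) : ℂ) * ∏ k : Fin N, A (π (fstPos k)) (π (sndPos k)) := rfl
  rw [reindex, Finset.sum_product, hpf, Finset.mul_sum]
  refine Finset.sum_congr rfl fun π _ => ?_
  change ∑ _q : Equiv.Perm (Fin N) × (Fin N → Equiv.Perm (Fin 2)),
    ((Equiv.Perm.sign π : ℤ) : ℂ) * ∏ k : Fin N, A (π (fstPos k)) (π (sndPos k)) = _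
  rw [Finset.sum_const, Finset.card_univ, nsmul_eq_mul]

lemma pf_eq_zero_of_det_eq_zero {A : Matrix (Fin (2 * N)) (Fin (2 * N)) ℂ} (hA : Aᵀ = -A)
    (h : A.det = 0) : pf A = 0 := by
  have := pfSum_eq_card_mul_pf hA
  rw [pfSum_eq_zero_of_det_eq_zero hA h] at this
  exact (mul_eq_zero.1 this.symm).resolve_left (Nat.cast_ne_zero.2 Fintype.card_ne_zero)

lemma pf_mul_mul_transpose {A : Matrix (Fin (2 * N)) (Fin (2 * N)) ℂ} (hA : Aᵀ = -A)
    (B : Matrix (Fin (2 * N)) (Fin (2 * N)) ℂ) : pf (B * A * Bᵀ) = B.det * pf A := by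
  have hskew : (B * A * Bᵀ)ᵀ = -(B * A * Bᵀ) := by
    simp [Matrix.transpose_mul, hA, Matrix.mul_assoc]
  have h := pfSum_mul_mul_transpose A B
  rw [pfSum_eq_card_mul_pf hA, pfSum_eq_card_mul_pf hskew, mul_left_comm] at h
  exact mul_left_cancel₀ (Nat.cast_ne_zero.2 Fintype.card_ne_zero) h

/-! ### Derivatives of Pfaffians and inverses along curves -/

/-- `L` depends only on the point `A` and the velocity `K`, so it may be computed along any
convenient curve. -/
lemma exists_hasDerivAt_pf (A K : Matrix (Fin (2 * N)) (Fin (2 * N)) ℂ) :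
    ∃ L : ℂ, ∀ (M : ℝ → Matrix (Fin (2 * N)) (Fin (2 * N)) ℂ) (s : ℝ), M s = A →
      (∀ i j, HasDerivAt (fun t => M t i j) (K i j) s) →
      HasDerivAt (fun t => pf (M t)) L s := by
  refine ⟨∑ π : Equiv.Perm (Fin (2 * N)) with IsPairing π, ((Equiv.Perm.sign π : ℤ) : ℂ) *
    ∑ k : Fin N, (∏ l ∈ Finset.univ.erase k, A (π (fstPos l)) (π (sndPos l))) •
      K (π (fstPos k)) (π (sndPos k)), fun M s hM hK => ?_⟩
  have := HasDerivAt.fun_sum (u := Finset.univ.filter (IsPairing (N := N))) fun π _ =>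
    (HasDerivAt.fun_finsetProd (u := (Finset.univ : Finset (Fin N)))
      (fun k _ => hK (π (fstPos k)) (π (sndPos k)))).const_mul ((Equiv.Perm.sign π : ℤ) : ℂ)
  rw [hM] at this
  exact this

/-- The derivative of the Pfaffian along a curve of skew-symmetric matrices, at an invertible
matrix. -/
lemma hasDerivAt_pf {M : ℝ → Matrix (Fin (2 * N)) (Fin (2 * N)) ℂ} {s : ℝ}
    {K : Matrix (Fin (2 * N)) (Fin (2 * N)) ℂ} (hM : (M s)ᵀ = -M s) (hKT : Kᵀ = -K)
    (hdet : (M s).det ≠ 0) (hK : ∀ i j, HasDerivAt (fun t => M t i j) (K i j) s) :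
    HasDerivAt (fun t => pf (M t)) (((M s)⁻¹ * K).trace / 2 * pf (M s)) s := by
  obtain ⟨L, hL⟩ := exists_hasDerivAt_pf (M s) K
  set A := M s with hA
  -- Chosen so that `B A` and `A Bᵀ` both equal `K / 2`: the congruence curve `(1 + t B) A (1 + t
  -- B)ᵀ` then has velocity `K` at `t = 0`, and its Pfaffian is `det (1 + t B) * pf A`.
  set B : Matrix (Fin (2 * N)) (Fin (2 * N)) ℂ := (1 / 2 : ℂ) • (K * A⁻¹) with hB
  have hu : IsUnit A.det := isUnit_iff_ne_zero.2 hdet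
  have hBA : B * A = (1 / 2 : ℂ) • K := by
    rw [hB, Matrix.smul_mul, Matrix.mul_assoc, Matrix.nonsing_inv_mul _ hu, Matrix.mul_one]
  have hAB : A * Bᵀ = (1 / 2 : ℂ) • K := by
    have hKT' : ((1 / 2 : ℂ) • K)ᵀ = -((1 / 2 : ℂ) • K) := by
      rw [Matrix.transpose_smul, hKT, smul_neg]
    have := congrArg Matrix.transpose hBA
    rw [hKT', Matrix.transpose_mul, hM, Matrix.neg_mul] at this
    exact neg_injective this
  let C : ℝ → Matrix (Fin (2 * N)) (Fin (2 * N)) ℂ := fun t => 1 + (t : ℂ) • B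
  have hC (t : ℝ) : C t * A * (C t)ᵀ = A + (t : ℂ) • K + (t : ℂ) ^ 2 • (B * A * Bᵀ) := by
    simp only [C, Matrix.transpose_add, Matrix.transpose_one, Matrix.transpose_smul, Matrix.add_mul,
      Matrix.mul_add, Matrix.one_mul, Matrix.mul_one, Matrix.smul_mul, Matrix.mul_smul, hAB, hBA]
    module
  have hofReal : HasDerivAt (fun t : ℝ => (t : ℂ)) 1 0 := Complex.ofRealCLM.hasDerivAt
  have h1 : HasDerivAt (fun t => pf (C t * A * (C t)ᵀ)) L 0 := by
    refine hL _ 0 (by simp [C]) fun i j => ?_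
    simp_rw [hC]
    have := ((hofReal.mul_const (K i j)).const_add (A i j)).fun_add
      ((hofReal.fun_pow 2).mul_const ((B * A * Bᵀ) i j))
    simpa using this
  have h2 : HasDerivAt (fun t => pf (C t * A * (C t)ᵀ)) (B.trace * pf A) 0 := by
    simp_rw [pf_mul_mul_transpose hM, C]
    refine HasDerivAt.mul_const ?_ _
    set Q := (Matrix.det (1 + (Polynomial.X : Polynomial ℂ) • B.map Polynomial.C)).divX.divX
      with hQdef
    have hexp : (fun t : ℝ => (1 + (t : ℂ) • B).det) =
        fun t : ℝ => 1 + B.trace * (t : ℂ) + Q.eval (t : ℂ) * (t : ℂ) ^ 2 :=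
      funext fun t => Matrix.det_one_add_smul _ _
    rw [hexp]
    have hQ : HasDerivAt (fun t : ℝ => Q.eval (t : ℂ)) (Q.derivative.eval ((0 : ℝ) : ℂ)) 0 :=
      (Q.hasDerivAt _).comp_ofReal
    have := ((hofReal.const_mul B.trace).const_add 1).fun_add (hQ.fun_mul (hofReal.fun_pow 2))
    simpa using this
  have hLval : L = (A⁻¹ * K).trace / 2 * pf A := by
    rw [h1.unique h2, hB, Matrix.trace_smul, Matrix.trace_mul_comm, smul_eq_mul]
    ring
  rw [← hLval]
  exact hL M s hA.symm hK

section curves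

variable {n : Type*} [Fintype n] [DecidableEq n]

lemma differentiableAt_det {M : ℝ → Matrix n n ℂ} {s : ℝ}
    (hM : ∀ i j, DifferentiableAt ℝ (fun t => M t i j) s) :
    DifferentiableAt ℝ (fun t => (M t).det) s := by
  simp only [Matrix.det_apply']
  fun_prop

lemma differentiableAt_inv_apply {M : ℝ → Matrix n n ℂ} {s : ℝ} (hdet : (M s).det ≠ 0)
    (hM : ∀ i j, DifferentiableAt ℝ (fun t => M t i j) s) (i j : n) :
    DifferentiableAt ℝ (fun t => (M t)⁻¹ i j) s := by
  have hadj : DifferentiableAt ℝ (fun t => (M t).adjugate i j) s := by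
    simp only [Matrix.adjugate_apply]
    refine differentiableAt_det fun k l => ?_
    by_cases hk : k = j
    · subst hk; simp
    · simpa [Matrix.updateRow_apply, hk] using hM k l
  have hd := (differentiableAt_det hM).inv hdet
  have heq : (fun t => (M t)⁻¹ i j) = fun t => ((M t).det)⁻¹ * (M t).adjugate i j := by
    funext t
    rw [Matrix.inv_def, Matrix.smul_apply, Ring.inverse_eq_inv', smul_eq_mul]
  rw [heq]
  exact hd.fun_mul hadj

lemma hasDerivAt_inv_apply {M : ℝ → Matrix n n ℂ} {K : Matrix n n ℂ} {s : ℝ}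
    (hdet : (M s).det ≠ 0) (hM : ∀ i j, HasDerivAt (fun t => M t i j) (K i j) s) (i j : n) :
    HasDerivAt (fun t => (M t)⁻¹ i j) (-((M s)⁻¹ * K * (M s)⁻¹) i j) s := by
  have hdiff := differentiableAt_inv_apply hdet fun i j => (hM i j).differentiableAt
  let X' : Matrix n n ℂ := Matrix.of fun i j => deriv (fun t => (M t)⁻¹ i j) s
  have hX (i j) : HasDerivAt (fun t => (M t)⁻¹ i j) (X' i j) s := (hdiff i j).hasDerivAt
  have hu : IsUnit (M s).det := isUnit_iff_ne_zero.2 hdet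
  have hprod : K * (M s)⁻¹ + M s * X' = 0 := by
    ext i j
    have h1 : HasDerivAt (fun t => (M t * (M t)⁻¹) i j) ((K * (M s)⁻¹ + M s * X') i j) s := by
      simp only [Matrix.mul_apply, Matrix.add_apply, ← Finset.sum_add_distrib]
      exact HasDerivAt.fun_sum fun k _ => (hM i k).fun_mul (hX k j)
    have hne : ∀ᶠ t in nhds s, (M t).det ≠ 0 :=
      (differentiableAt_det fun i j => (hM i j).differentiableAt).continuousAt.eventually_ne hdet
    have h2 : (fun t => (M t * (M t)⁻¹) i j) =ᶠ[nhds s]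
        fun _ => (1 : Matrix n n ℂ) i j := by
      filter_upwards [hne] with t ht
      rw [Matrix.mul_nonsing_inv _ (isUnit_iff_ne_zero.2 ht)]
    exact h1.unique ((hasDerivAt_const s _).congr_of_eventuallyEq h2)
  have hX' : X' = -((M s)⁻¹ * K * (M s)⁻¹) := by
    have := congrArg (fun Y => (M s)⁻¹ * Y) (eq_neg_of_add_eq_zero_right hprod)
    simp only [Matrix.mul_neg, ← Matrix.mul_assoc, Matrix.nonsing_inv_mul _ hu,
      Matrix.one_mul] at this
    exact this
  rw [← Matrix.neg_apply, ← hX']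
  exact hX i j

/-- The derivative of `u ⬝ᵥ M⁻¹ w` along curves `M`, `u`, `w`. -/
lemma hasDerivAt_dotProduct_inv_mulVec {M : ℝ → Matrix n n ℂ} {K : Matrix n n ℂ} {s : ℝ}
    {u w : ℝ → n → ℂ} {u' w' : n → ℂ}
    (hdet : (M s).det ≠ 0) (hM : ∀ i j, HasDerivAt (fun t => M t i j) (K i j) s)
    (hu : ∀ i, HasDerivAt (fun t => u t i) (u' i) s)
    (hw : ∀ i, HasDerivAt (fun t => w t i) (w' i) s) :
    HasDerivAt (fun t => u t ⬝ᵥ (M t)⁻¹ *ᵥ w t)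
      (u' ⬝ᵥ (M s)⁻¹ *ᵥ w s + u s ⬝ᵥ (M s)⁻¹ *ᵥ w' -
        u s ⬝ᵥ (M s)⁻¹ *ᵥ K *ᵥ (M s)⁻¹ *ᵥ w s) s := by
  have h := HasDerivAt.fun_sum (u := (Finset.univ : Finset n)) fun i _ =>
    (hu i).fun_mul (HasDerivAt.fun_sum (u := (Finset.univ : Finset n)) fun j _ =>
      (hasDerivAt_inv_apply hdet hM i j).fun_mul (hw j))
  refine HasDerivAt.congr_deriv h ?_
  rw [Matrix.mulVec_mulVec, Matrix.mulVec_mulVec]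
  simp only [dotProduct, Matrix.mulVec]
  simp only [← Finset.sum_add_distrib, ← Finset.sum_sub_distrib,
    add_sub_assoc, ← mul_sub]
  refine Finset.sum_congr rfl fun i _ => ?_
  congr 2
  refine Finset.sum_congr rfl fun j _ => ?_
  ring

end curves

/-! ### Brackets and the reduction condition -/

lemma dotProduct_mulVec_vecMulVec {n : Type*} [Fintype n] (A : Matrix n n ℂ) (a b u w : n → ℂ) :
    u ⬝ᵥ A *ᵥ vecMulVec a b *ᵥ A *ᵥ w = (u ⬝ᵥ A *ᵥ a) * (b ⬝ᵥ A *ᵥ w) := by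
  rw [Matrix.vecMulVec_mulVec, op_smul_eq_smul, Matrix.mulVec_smul, dotProduct_smul, smul_eq_mul,
    mul_comm]

lemma trace_mul_vecMulVec {n : Type*} [Fintype n] (A : Matrix n n ℂ) (a b : n → ℂ) :
    (A * vecMulVec a b).trace = b ⬝ᵥ A *ᵥ a := by
  rw [Matrix.mul_vecMulVec, Matrix.trace_vecMulVec, dotProduct_comm]

/-- The matrix `pf(i, j)`. -/
noncomputable def entryMatrix (p c ξ₀ : Fin (2 * N) → ℂ) (x y : ℝ) :
    Matrix (Fin (2 * N)) (Fin (2 * N)) ℂ :=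
  Matrix.of (entry p c ξ₀ x y)

/-- The vector `p_i ^ n e^{ξ_i}`. -/
noncomputable def expVec (p ξ₀ : Fin (2 * N) → ℂ) (n : ℤ) (x y : ℝ) (i : Fin (2 * N)) : ℂ :=
  p i ^ n * Complex.exp (phase p ξ₀ i x y)

/-- The bilinear form of the inverse of the matrix `pf(i, j)` at the vectors `p_i ^ m e^{ξ_i}` and
`p_i ^ n e^{ξ_i}`. -/
noncomputable def bracket (p c ξ₀ : Fin (2 * N) → ℂ) (m n : ℤ) (x y : ℝ) : ℂ :=
  expVec p ξ₀ m x y ⬝ᵥ (entryMatrix p c ξ₀ x y)⁻¹ *ᵥ expVec p ξ₀ n x y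

section

variable {p c ξ₀ : Fin (2 * N) → ℂ} {x y : ℝ}

lemma add_ne_zero_of_ne (hp0 : ∀ i, p i ≠ 0) (hpp : ∀ i j, i ≠ j → p i + p j ≠ 0)
    (i j : Fin (2 * N)) : p i + p j ≠ 0 := by
  rcases eq_or_ne i j with rfl | h
  · rw [← two_mul]; exact mul_ne_zero two_ne_zero (hp0 i)
  · exact hpp i j h

lemma transpose_entryMatrix (hc : ∀ i, c i = -c (Fin.rev i)) :
    (entryMatrix p c ξ₀ x y)ᵀ = -entryMatrix p c ξ₀ x y := by
  ext i j
  simp only [Matrix.transpose_apply, entryMatrix, Matrix.of_apply, Matrix.neg_apply, entry]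
  rw [add_comm (p j), add_comm (phase p ξ₀ j x y), ← neg_sub (p i) (p j)]
  by_cases h : j = Fin.rev i
  · subst h
    rw [if_pos (Fin.rev_rev i).symm, if_pos rfl, hc i]
    ring
  · rw [if_neg h, if_neg fun h' => h (by rw [h', Fin.rev_rev])]
    ring

lemma hasDerivAt_phase_fst (i : Fin (2 * N)) :
    HasDerivAt (fun s => phase p ξ₀ i s y) (p i) x := by
  have h : HasDerivAt (fun t : ℝ => (t : ℂ)) 1 x := Complex.ofRealCLM.hasDerivAt
  exact (((h.const_mul (p i)).add_const ((p i)⁻¹ * y)).add_const (ξ₀ i)).congr_deriv (mul_one _)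

lemma hasDerivAt_phase_snd (i : Fin (2 * N)) :
    HasDerivAt (fun s => phase p ξ₀ i x s) (p i)⁻¹ y := by
  have h : HasDerivAt (fun t : ℝ => (t : ℂ)) 1 y := Complex.ofRealCLM.hasDerivAt
  exact (((h.const_mul (p i)⁻¹).const_add (p i * x)).add_const (ξ₀ i)).congr_deriv (mul_one _)

lemma hasDerivAt_expVec_fst (hp0 : ∀ i, p i ≠ 0) (n : ℤ) (i : Fin (2 * N)) :
    HasDerivAt (fun s => expVec p ξ₀ n s y i) (expVec p ξ₀ (n + 1) x y i) x := by
  have h := ((hasDerivAt_phase_fst (p := p) (ξ₀ := ξ₀) (x := x) (y := y) i).cexp).const_mul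
    (p i ^ n)
  refine HasDerivAt.congr_deriv h ?_
  rw [expVec, zpow_add_one₀ (hp0 i)]; ring

lemma hasDerivAt_expVec_snd (hp0 : ∀ i, p i ≠ 0) (n : ℤ) (i : Fin (2 * N)) :
    HasDerivAt (fun s => expVec p ξ₀ n x s i) (expVec p ξ₀ (n - 1) x y i) y := by
  have h := ((hasDerivAt_phase_snd (p := p) (ξ₀ := ξ₀) (x := x) (y := y) i).cexp).const_mul
    (p i ^ n)
  refine HasDerivAt.congr_deriv h ?_
  rw [expVec, zpow_sub_one₀ (hp0 i)]; ring

lemma hasDerivAt_entryMatrix_fst (hs : ∀ i j, p i + p j ≠ 0) (i j : Fin (2 * N)) :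
    HasDerivAt (fun s => entryMatrix p c ξ₀ s y i j)
      ((vecMulVec (expVec p ξ₀ 1 x y) (expVec p ξ₀ 0 x y) -
        vecMulVec (expVec p ξ₀ 0 x y) (expVec p ξ₀ 1 x y)) i j) x := by
  have h := ((((hasDerivAt_phase_fst (p := p) (ξ₀ := ξ₀) (x := x) (y := y) i).fun_add
    (hasDerivAt_phase_fst (p := p) (ξ₀ := ξ₀) (x := x) (y := y) j)).cexp).const_mul
      ((p i - p j) / (p i + p j))).const_add (if j = Fin.rev i then c i else 0)
  refine HasDerivAt.congr_deriv h ?_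
  simp only [Matrix.sub_apply, Matrix.vecMulVec_apply, expVec, zpow_one, zpow_zero, Complex.exp_add]
  field_simp [hs i j]

lemma hasDerivAt_entryMatrix_snd (hp0 : ∀ i, p i ≠ 0) (hs : ∀ i j, p i + p j ≠ 0)
    (i j : Fin (2 * N)) :
    HasDerivAt (fun s => entryMatrix p c ξ₀ x s i j)
      ((vecMulVec (expVec p ξ₀ 0 x y) (expVec p ξ₀ (-1) x y) -
        vecMulVec (expVec p ξ₀ (-1) x y) (expVec p ξ₀ 0 x y)) i j) y := by
  have h := ((((hasDerivAt_phase_snd (p := p) (ξ₀ := ξ₀) (x := x) (y := y) i).fun_add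
    (hasDerivAt_phase_snd (p := p) (ξ₀ := ξ₀) (x := x) (y := y) j)).cexp).const_mul
      ((p i - p j) / (p i + p j))).const_add (if j = Fin.rev i then c i else 0)
  refine HasDerivAt.congr_deriv h ?_
  simp only [Matrix.sub_apply, Matrix.vecMulVec_apply, expVec, _root_.zpow_neg_one, zpow_zero,
    Complex.exp_add]
  have := hs i j
  have := hp0 i
  have := hp0 j
  field_simp
  ring

lemma bracket_skew (hc : ∀ i, c i = -c (Fin.rev i)) (m n : ℤ) :
    bracket p c ξ₀ m n x y = -bracket p c ξ₀ n m x y := by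
  have hinv : ((entryMatrix p c ξ₀ x y)⁻¹)ᵀ = -(entryMatrix p c ξ₀ x y)⁻¹ := by
    rw [Matrix.transpose_nonsing_inv, transpose_entryMatrix hc]
    by_cases h : IsUnit (entryMatrix p c ξ₀ x y).det
    · refine Matrix.inv_eq_left_inv ?_
      rw [neg_mul_neg, Matrix.nonsing_inv_mul _ h]
    -- In the singular case both inverses are `0` by convention.
    · have h' : ¬ IsUnit (-entryMatrix p c ξ₀ x y).det := by
        rw [← transpose_entryMatrix hc, Matrix.det_transpose]; exact h
      rw [Matrix.nonsing_inv_apply_not_isUnit _ h, Matrix.nonsing_inv_apply_not_isUnit _ h',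
        neg_zero]
  unfold bracket
  rw [Matrix.dotProduct_mulVec, dotProduct_comm, ← Matrix.mulVec_transpose, hinv, Matrix.neg_mulVec,
    dotProduct_neg]

lemma bracket_self (hc : ∀ i, c i = -c (Fin.rev i)) (m : ℤ) : bracket p c ξ₀ m m x y = 0 :=
  self_eq_neg.1 (bracket_skew hc m m)

lemma hasDerivAt_bracket_fst (hp0 : ∀ i, p i ≠ 0) (hs : ∀ i j, p i + p j ≠ 0)
    (hdet : (entryMatrix p c ξ₀ x y).det ≠ 0) (m n : ℤ) :
    HasDerivAt (fun s => bracket p c ξ₀ m n s y)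
      (bracket p c ξ₀ (m + 1) n x y + bracket p c ξ₀ m (n + 1) x y -
        bracket p c ξ₀ m 1 x y * bracket p c ξ₀ 0 n x y +
        bracket p c ξ₀ m 0 x y * bracket p c ξ₀ 1 n x y) x := by
  have h := hasDerivAt_dotProduct_inv_mulVec (M := fun s => entryMatrix p c ξ₀ s y) hdet
    (hasDerivAt_entryMatrix_fst hs) (hasDerivAt_expVec_fst (ξ₀ := ξ₀) (y := y) hp0 m)
    (hasDerivAt_expVec_fst (ξ₀ := ξ₀) (y := y) hp0 n)
  refine HasDerivAt.congr_deriv h ?_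
  rw [Matrix.sub_mulVec, Matrix.mulVec_sub, dotProduct_sub, dotProduct_mulVec_vecMulVec,
    dotProduct_mulVec_vecMulVec]
  unfold bracket
  ring

lemma hasDerivAt_bracket_snd (hp0 : ∀ i, p i ≠ 0) (hs : ∀ i j, p i + p j ≠ 0)
    (hdet : (entryMatrix p c ξ₀ x y).det ≠ 0) (m n : ℤ) :
    HasDerivAt (fun s => bracket p c ξ₀ m n x s)
      (bracket p c ξ₀ (m - 1) n x y + bracket p c ξ₀ m (n - 1) x y -
        bracket p c ξ₀ m 0 x y * bracket p c ξ₀ (-1) n x y +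
        bracket p c ξ₀ m (-1) x y * bracket p c ξ₀ 0 n x y) y := by
  have h := hasDerivAt_dotProduct_inv_mulVec (M := fun s => entryMatrix p c ξ₀ x s) hdet
    (hasDerivAt_entryMatrix_snd hp0 hs) (hasDerivAt_expVec_snd (ξ₀ := ξ₀) (x := x) hp0 m)
    (hasDerivAt_expVec_snd (ξ₀ := ξ₀) (x := x) hp0 n)
  refine HasDerivAt.congr_deriv h ?_
  rw [Matrix.sub_mulVec, Matrix.mulVec_sub, dotProduct_sub, dotProduct_mulVec_vecMulVec,
    dotProduct_mulVec_vecMulVec]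
  unfold bracket
  ring

lemma hasDerivAt_tau_fst (hs : ∀ i j, p i + p j ≠ 0)
    (hc : ∀ i, c i = -c (Fin.rev i)) (hdet : (entryMatrix p c ξ₀ x y).det ≠ 0) :
    HasDerivAt (fun s => tau p c ξ₀ s y) (tau p c ξ₀ x y * bracket p c ξ₀ 0 1 x y) x := by
  have h := hasDerivAt_pf (M := fun s => entryMatrix p c ξ₀ s y) (transpose_entryMatrix hc)
    (by rw [Matrix.transpose_sub, Matrix.transpose_vecMulVec, Matrix.transpose_vecMulVec, neg_sub])
    hdet (hasDerivAt_entryMatrix_fst hs)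
  refine HasDerivAt.congr_deriv h ?_
  rw [Matrix.mul_sub, Matrix.trace_sub, trace_mul_vecMulVec, trace_mul_vecMulVec]
  change (bracket p c ξ₀ 0 1 x y - bracket p c ξ₀ 1 0 x y) / 2 * tau p c ξ₀ x y = _
  rw [bracket_skew hc 1 0]
  ring

lemma hasDerivAt_tau_snd (hp0 : ∀ i, p i ≠ 0) (hs : ∀ i j, p i + p j ≠ 0)
    (hc : ∀ i, c i = -c (Fin.rev i)) (hdet : (entryMatrix p c ξ₀ x y).det ≠ 0) :
    HasDerivAt (fun s => tau p c ξ₀ x s) (tau p c ξ₀ x y * bracket p c ξ₀ (-1) 0 x y) y := by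
  have h := hasDerivAt_pf (M := fun s => entryMatrix p c ξ₀ x s) (transpose_entryMatrix hc)
    (by rw [Matrix.transpose_sub, Matrix.transpose_vecMulVec, Matrix.transpose_vecMulVec, neg_sub])
    hdet (hasDerivAt_entryMatrix_snd hp0 hs)
  refine HasDerivAt.congr_deriv h ?_
  rw [Matrix.mul_sub, Matrix.trace_sub, trace_mul_vecMulVec, trace_mul_vecMulVec]
  change (bracket p c ξ₀ (-1) 0 x y - bracket p c ξ₀ 0 (-1) x y) / 2 * tau p c ξ₀ x y = _
  rw [bracket_skew hc 0 (-1)]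
  ring

lemma cube_rev (hp : ∀ i, p i ^ 2 - p i * p (Fin.rev i) + p (Fin.rev i) ^ 2 = 0)
    (i : Fin (2 * N)) : p i ^ 3 + p (Fin.rev i) ^ 3 = 0 := by
  linear_combination (p i + p (Fin.rev i)) * hp i

/-- The reduction condition makes the derivative of `log τ` along `x_3` vanish. -/
lemma bracket_zero_three (hs : ∀ i j, p i + p j ≠ 0)
    (hc : ∀ i, c i = -c (Fin.rev i))
    (hp : ∀ i, p i ^ 2 - p i * p (Fin.rev i) + p (Fin.rev i) ^ 2 = 0)
    (hdet : (entryMatrix p c ξ₀ x y).det ≠ 0) :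
    bracket p c ξ₀ 0 3 x y = 2 * bracket p c ξ₀ 1 2 x y := by
  set A := entryMatrix p c ξ₀ x y with hA
  have hu : IsUnit A.det := isUnit_iff_ne_zero.2 hdet
  let Q : Matrix (Fin (2 * N)) (Fin (2 * N)) ℂ := Matrix.diagonal fun i => p i ^ 3
  have hQ : Q.trace = 0 := by
    have h1 : Q.trace = ∑ i, p i ^ 3 := Matrix.trace_diagonal _
    have h2 : ∑ i, p (Fin.rev i) ^ 3 = ∑ i, p i ^ 3 :=
      Equiv.sum_comp Fin.revPerm fun i => p i ^ 3
    have h3 : ∑ i, p i ^ 3 + ∑ i, p (Fin.rev i) ^ 3 = 0 := by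
      rw [← Finset.sum_add_distrib]
      exact Finset.sum_eq_zero fun i _ => cube_rev hp i
    rw [h1]
    linear_combination (1 / 2 : ℂ) * h3 - (1 / 2 : ℂ) * h2
  -- The factor `p_i ^ 3 + p_j ^ 3` is divisible by `p_i + p_j`, and it vanishes at `j = Fin.rev i`,
  -- where `c i` sits.
  have hK : Q * A + A * Q =
      vecMulVec (expVec p ξ₀ 3 x y) (expVec p ξ₀ 0 x y) -
        (2 : ℂ) • vecMulVec (expVec p ξ₀ 2 x y) (expVec p ξ₀ 1 x y) +
        (2 : ℂ) • vecMulVec (expVec p ξ₀ 1 x y) (expVec p ξ₀ 2 x y) -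
        vecMulVec (expVec p ξ₀ 0 x y) (expVec p ξ₀ 3 x y) := by
    ext i j
    have hq : p i ^ 3 * (if j = Fin.rev i then c i else 0) +
        (if j = Fin.rev i then c i else 0) * p j ^ 3 = 0 := by
      split_ifs with h
      · rw [h]; linear_combination c i * cube_rev hp i
      · ring
    have hfrac : (p i ^ 3 + p j ^ 3) * ((p i - p j) / (p i + p j)) =
        p i ^ 3 - 2 * p i ^ 2 * p j + 2 * p i * p j ^ 2 - p j ^ 3 := by
      have := hs i j
      field_simp
      ring
    have e3 (k) : p k ^ (3 : ℤ) = p k ^ 3 := by norm_cast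
    have e2 (k) : p k ^ (2 : ℤ) = p k ^ 2 := by norm_cast
    simp only [Q, Matrix.add_apply, Matrix.sub_apply, Matrix.smul_apply, Matrix.diagonal_mul,
      Matrix.mul_diagonal, Matrix.vecMulVec_apply, expVec, zpow_one, zpow_zero, e3, e2, smul_eq_mul,
      hA, entryMatrix, Matrix.of_apply, entry, Complex.exp_add]
    linear_combination hq +
      (Complex.exp (phase p ξ₀ i x y) * Complex.exp (phase p ξ₀ j x y)) * hfrac
  have htr : (A⁻¹ * (Q * A + A * Q)).trace = 0 := by
    rw [Matrix.mul_add, Matrix.trace_add, ← Matrix.mul_assoc, ← Matrix.mul_assoc,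
      Matrix.nonsing_inv_mul _ hu, Matrix.one_mul, Matrix.trace_mul_comm, ← Matrix.mul_assoc,
      Matrix.mul_nonsing_inv _ hu, Matrix.one_mul, hQ, add_zero]
  rw [hK] at htr
  simp only [Matrix.mul_add, Matrix.mul_sub, Matrix.mul_smul, Matrix.trace_add, Matrix.trace_sub,
    Matrix.trace_smul, trace_mul_vecMulVec, smul_eq_mul] at htr
  change bracket p c ξ₀ 0 3 x y - 2 * bracket p c ξ₀ 1 2 x y + 2 * bracket p c ξ₀ 2 1 x y -
    bracket p c ξ₀ 3 0 x y = 0 at htr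
  rw [bracket_skew hc 2 1, bracket_skew hc 3 0] at htr
  linear_combination (1 / 2 : ℂ) * htr

end

/-! ### Hirota derivatives through partial derivatives -/

/-- The partial derivative `∂_{x_1}`. -/
noncomputable def partialOne (f : ℝ → ℝ → ℂ) : ℝ → ℝ → ℂ := fun x y => deriv (fun s => f s y) x

/-- The partial derivative `∂_{x_{-1}}`. -/
noncomputable def partialNegOne (f : ℝ → ℝ → ℂ) : ℝ → ℝ → ℂ :=
  fun x y => deriv (fun s => f x s) y

section smooth

variable {f : ℝ → ℝ → ℂ}

lemma hasDerivAt_partialOne (hf : ContDiff ℝ ∞ (fun z : ℝ × ℝ => f z.1 z.2)) (x y : ℝ) :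
    HasDerivAt (fun s => f s y) (partialOne f x y) x := by
  have h : ContDiff ℝ ∞ (fun s : ℝ => f s y) :=
    hf.comp (contDiff_id.prodMk contDiff_const : ContDiff ℝ ∞ fun s : ℝ => (s, y))
  exact (h.differentiable (by simp) x).hasDerivAt

lemma hasDerivAt_partialNegOne (hf : ContDiff ℝ ∞ (fun z : ℝ × ℝ => f z.1 z.2)) (x y : ℝ) :
    HasDerivAt (fun s => f x s) (partialNegOne f x y) y := by
  have h : ContDiff ℝ ∞ (fun s : ℝ => f x s) :=
    hf.comp (contDiff_const.prodMk contDiff_id : ContDiff ℝ ∞ fun s : ℝ => (x, s))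
  exact (h.differentiable (by simp) y).hasDerivAt

lemma contDiff_partialOne (hf : ContDiff ℝ ∞ (fun z : ℝ × ℝ => f z.1 z.2)) :
    ContDiff ℝ ∞ (fun z : ℝ × ℝ => partialOne f z.1 z.2) := by
  have heq : (fun z : ℝ × ℝ => partialOne f z.1 z.2) =
      fun z => fderiv ℝ (fun z : ℝ × ℝ => f z.1 z.2) z (1, 0) := by
    funext z
    have h1 := (hf.differentiable (by simp) z).hasFDerivAt
    have h2 : HasDerivAt (fun s : ℝ => (s, z.2)) ((1 : ℝ), (0 : ℝ)) z.1 :=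
      (hasDerivAt_id z.1).prodMk (hasDerivAt_const z.1 z.2)
    have h3 := HasFDerivAt.comp_hasDerivAt (l := fun z : ℝ × ℝ => f z.1 z.2) z.1 h1 h2
    exact (hasDerivAt_partialOne hf z.1 z.2).unique h3
  rw [heq]
  exact (hf.fderiv_right (m := ∞) (by simp)).clm_apply contDiff_const

lemma contDiff_partialNegOne (hf : ContDiff ℝ ∞ (fun z : ℝ × ℝ => f z.1 z.2)) :
    ContDiff ℝ ∞ (fun z : ℝ × ℝ => partialNegOne f z.1 z.2) := by
  have heq : (fun z : ℝ × ℝ => partialNegOne f z.1 z.2) =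
      fun z => fderiv ℝ (fun z : ℝ × ℝ => f z.1 z.2) z (0, 1) := by
    funext z
    have h1 := (hf.differentiable (by simp) z).hasFDerivAt
    have h2 : HasDerivAt (fun s : ℝ => (z.1, s)) ((0 : ℝ), (1 : ℝ)) z.2 :=
      (hasDerivAt_const z.2 z.1).prodMk (hasDerivAt_id z.2)
    have h3 := HasFDerivAt.comp_hasDerivAt (l := fun z : ℝ × ℝ => f z.1 z.2) z.2 h1 h2
    exact (hasDerivAt_partialNegOne hf z.1 z.2).unique h3
  rw [heq]
  exact (hf.fderiv_right (m := ∞) (by simp)).clm_apply contDiff_const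

lemma eventually_partialOne_eq_zero {z : ℝ × ℝ} (h : ∀ᶠ w in nhds z, f w.1 w.2 = 0) :
    ∀ᶠ w in nhds z, partialOne f w.1 w.2 = 0 := by
  filter_upwards [eventually_eventually_nhds.2 h] with w hw
  have hcont : Filter.Tendsto (fun s : ℝ => (s, w.2)) (nhds w.1) (nhds w) :=
    (continuous_id.prodMk continuous_const).tendsto w.1
  have : (fun s => f s w.2) =ᶠ[nhds w.1] fun _ => 0 := hcont.eventually hw
  rw [partialOne, this.deriv_eq, deriv_const]

lemma diffOne_mul (f g : ℝ → ℝ → ℂ) :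
    diffOne (fun x y x' y' => f x y * g x' y') =
      fun x y x' y' => partialOne f x y * g x' y' - f x y * partialOne g x' y' := by
  funext x y x' y'
  simp only [diffOne, deriv_mul_const_field, deriv_const_mul_field, partialOne]

lemma diffOne_iterate_two (hf : ContDiff ℝ ∞ (fun z : ℝ × ℝ => f z.1 z.2)) :
    diffOne^[2] (fun x y x' y' => f x y * f x' y') =
      fun x y x' y' => partialOne (partialOne f) x y * f x' y' -
        2 * (partialOne f x y * partialOne f x' y') +
        f x y * partialOne (partialOne f) x' y' := by
  rw [Function.iterate_succ_apply', Function.iterate_one, diffOne_mul]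
  funext x y x' y'
  have h0 := hasDerivAt_partialOne hf
  have h1 := hasDerivAt_partialOne (contDiff_partialOne hf)
  have e1 := (((h1 x y).mul_const (f x' y')).fun_sub
    ((h0 x y).mul_const (partialOne f x' y'))).deriv
  have e2 := (((h0 x' y').const_mul (partialOne f x y)).fun_sub
    ((h1 x' y').const_mul (f x y))).deriv
  rw [diffOne, e1, e2]
  ring

lemma diffOne_iterate_three (hf : ContDiff ℝ ∞ (fun z : ℝ × ℝ => f z.1 z.2)) :
    diffOne^[3] (fun x y x' y' => f x y * f x' y') =
      fun x y x' y' => partialOne (partialOne (partialOne f)) x y * f x' y' -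
        3 * (partialOne (partialOne f) x y * partialOne f x' y') +
        3 * (partialOne f x y * partialOne (partialOne f) x' y') -
        f x y * partialOne (partialOne (partialOne f)) x' y' := by
  rw [Function.iterate_succ_apply', diffOne_iterate_two hf]
  funext x y x' y'
  have h0 := hasDerivAt_partialOne hf
  have h1 := hasDerivAt_partialOne (contDiff_partialOne hf)
  have h2 := hasDerivAt_partialOne (contDiff_partialOne (contDiff_partialOne hf))
  have e1 := ((((h2 x y).mul_const (f x' y')).fun_sub
    (((h1 x y).mul_const (partialOne f x' y')).const_mul 2)).fun_add
    ((h0 x y).mul_const (partialOne (partialOne f) x' y'))).deriv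
  have e2 := ((((h0 x' y').const_mul (partialOne (partialOne f) x y)).fun_sub
    (((h1 x' y').const_mul (partialOne f x y)).const_mul 2)).fun_add
    ((h2 x' y').const_mul (f x y))).deriv
  rw [diffOne, e1, e2]
  ring

lemma hirota_zero_two (hf : ContDiff ℝ ∞ (fun z : ℝ × ℝ => f z.1 z.2)) (x y : ℝ) :
    hirota 0 2 f f x y =
      2 * (partialOne (partialOne f) x y * f x y - partialOne f x y ^ 2) := by
  rw [hirota, diffOne_iterate_two hf, Function.iterate_zero_apply]
  ring

lemma hirota_one_three (hf : ContDiff ℝ ∞ (fun z : ℝ × ℝ => f z.1 z.2)) (x y : ℝ) :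
    hirota 1 3 f f x y =
      2 * (partialNegOne (partialOne (partialOne (partialOne f))) x y * f x y -
        3 * partialNegOne (partialOne (partialOne f)) x y * partialOne f x y +
        3 * partialNegOne (partialOne f) x y * partialOne (partialOne f) x y -
        partialNegOne f x y * partialOne (partialOne (partialOne f)) x y) := by
  rw [hirota, diffOne_iterate_three hf, Function.iterate_one]
  have c1 := contDiff_partialOne hf
  have c2 := contDiff_partialOne c1
  have h0 := hasDerivAt_partialNegOne hf x y
  have h1 := hasDerivAt_partialNegOne c1 x y
  have h2 := hasDerivAt_partialNegOne c2 x y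
  have h3 := hasDerivAt_partialNegOne (contDiff_partialOne c2) x y
  have e1 := ((((h3.mul_const (f x y)).fun_sub
    ((h2.mul_const (partialOne f x y)).const_mul 3)).fun_add
    ((h1.mul_const (partialOne (partialOne f) x y)).const_mul 3)).fun_sub
    (h0.mul_const (partialOne (partialOne (partialOne f)) x y))).deriv
  have e2 := ((((h0.const_mul (partialOne (partialOne (partialOne f)) x y)).fun_sub
    ((h1.const_mul (partialOne (partialOne f) x y)).const_mul 3)).fun_add
    ((h2.const_mul (partialOne f x y)).const_mul 3)).fun_sub
    (h3.const_mul (f x y))).deriv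
  rw [diffNegOne, e1, e2]
  ring

end smooth

/-! ### The bilinear equation -/

section

variable {p c ξ₀ : Fin (2 * N) → ℂ} {x y : ℝ}

lemma contDiff_tau (p c ξ₀ : Fin (2 * N) → ℂ) :
    ContDiff ℝ ∞ (fun z : ℝ × ℝ => tau p c ξ₀ z.1 z.2) := by
  have hphase (i) : ContDiff ℝ ∞ (fun z : ℝ × ℝ => phase p ξ₀ i z.1 z.2) := by
    have h1 : ContDiff ℝ ∞ (fun z : ℝ × ℝ => (z.1 : ℂ)) :=
      Complex.ofRealCLM.contDiff.comp contDiff_fst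
    have h2 : ContDiff ℝ ∞ (fun z : ℝ × ℝ => (z.2 : ℂ)) :=
      Complex.ofRealCLM.contDiff.comp contDiff_snd
    exact ((contDiff_const.mul h1).add (contDiff_const.mul h2)).add contDiff_const
  have hentry (i j) : ContDiff ℝ ∞ (fun z : ℝ × ℝ => entry p c ξ₀ z.1 z.2 i j) :=
    contDiff_const.add (contDiff_const.mul ((hphase i).add (hphase j)).cexp)
  exact ContDiff.sum fun π _ => contDiff_const.mul (contDiff_prod fun k _ => hentry _ _)

/-- Bracket formulas hold only where `det ≠ 0`; that set is open along the line, so they may be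
differentiated there. -/
lemma partialOne_eq_of_det_ne_zero (hs : ∀ i j, p i + p j ≠ 0) {f g : ℝ → ℝ → ℂ} {g' : ℂ}
    (hfg : ∀ x y, (entryMatrix p c ξ₀ x y).det ≠ 0 → f x y = g x y)
    (hdet : (entryMatrix p c ξ₀ x y).det ≠ 0) (hg : HasDerivAt (fun s => g s y) g' x) :
    partialOne f x y = g' := by
  have hne : ∀ᶠ s in nhds x, (entryMatrix p c ξ₀ s y).det ≠ 0 :=
    (differentiableAt_det fun i j =>
      (hasDerivAt_entryMatrix_fst hs i j).differentiableAt).continuousAt.eventually_ne hdet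
  exact (hg.congr_of_eventuallyEq (hne.mono fun s h => hfg s y h)).deriv

lemma partialNegOne_eq_of_det_ne_zero (hp0 : ∀ i, p i ≠ 0) (hs : ∀ i j, p i + p j ≠ 0)
    {f g : ℝ → ℝ → ℂ} {g' : ℂ}
    (hfg : ∀ x y, (entryMatrix p c ξ₀ x y).det ≠ 0 → f x y = g x y)
    (hdet : (entryMatrix p c ξ₀ x y).det ≠ 0) (hg : HasDerivAt (fun s => g x s) g' y) :
    partialNegOne f x y = g' := by
  have hne : ∀ᶠ s in nhds y, (entryMatrix p c ξ₀ x s).det ≠ 0 :=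
    (differentiableAt_det fun i j =>
      (hasDerivAt_entryMatrix_snd hp0 hs i j).differentiableAt).continuousAt.eventually_ne hdet
  exact (hg.congr_of_eventuallyEq (hne.mono fun s h => hfg x s h)).deriv

/-- The bilinear form of the equation, written with partial derivatives. -/
noncomputable def bilinearForm (f : ℝ → ℝ → ℂ) (x y : ℝ) : ℂ :=
  partialNegOne (partialOne (partialOne (partialOne f))) x y * f x y -
    3 * partialNegOne (partialOne (partialOne f)) x y * partialOne f x y +
    3 * partialNegOne (partialOne f) x y * partialOne (partialOne f) x y -
    partialNegOne f x y * partialOne (partialOne (partialOne f)) x y -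
    3 * (partialOne (partialOne f) x y * f x y - partialOne f x y ^ 2)

lemma bilinearForm_tau_of_det_ne_zero (hp0 : ∀ i, p i ≠ 0) (hs : ∀ i j, p i + p j ≠ 0)
    (hc : ∀ i, c i = -c (Fin.rev i))
    (hp : ∀ i, p i ^ 2 - p i * p (Fin.rev i) + p (Fin.rev i) ^ 2 = 0)
    (hdet : (entryMatrix p c ξ₀ x y).det ≠ 0) : bilinearForm (tau p c ξ₀) x y = 0 := by
  set τ := tau p c ξ₀ with hτ
  set b := bracket p c ξ₀ with hb
  have t1 : ∀ x y, (entryMatrix p c ξ₀ x y).det ≠ 0 → partialOne τ x y = τ x y * b 0 1 x y :=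
    fun x y h => (hasDerivAt_tau_fst hs hc h).deriv
  have t2 : ∀ x y, (entryMatrix p c ξ₀ x y).det ≠ 0 →
      partialOne (partialOne τ) x y = τ x y * b 0 2 x y := fun x y h => by
    rw [partialOne_eq_of_det_ne_zero hs t1 h
      ((hasDerivAt_tau_fst hs hc h).fun_mul (hasDerivAt_bracket_fst hp0 hs h 0 1))]
    norm_num only
    rw [bracket_self hc 0, bracket_self hc 1, hb, hτ]
    ring
  have t3 : ∀ x y, (entryMatrix p c ξ₀ x y).det ≠ 0 →
      partialOne (partialOne (partialOne τ)) x y = τ x y * (b 1 2 x y + b 0 3 x y) :=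
    fun x y h => by
    rw [partialOne_eq_of_det_ne_zero hs t2 h
      ((hasDerivAt_tau_fst hs hc h).fun_mul (hasDerivAt_bracket_fst hp0 hs h 0 2))]
    norm_num only
    rw [bracket_self hc 0, hb, hτ]
    ring
  have s0 : partialNegOne τ x y = τ x y * b (-1) 0 x y :=
    (hasDerivAt_tau_snd hp0 hs hc hdet).deriv
  have d (m n : ℤ) := (hasDerivAt_tau_snd hp0 hs hc hdet).fun_mul
    (hasDerivAt_bracket_snd hp0 hs hdet m n)
  have s1 : partialNegOne (partialOne τ) x y = τ x y * b (-1) 1 x y := by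
    rw [partialNegOne_eq_of_det_ne_zero hp0 hs t1 hdet (d 0 1)]
    norm_num only
    rw [bracket_self hc 0, bracket_skew hc 0 (-1), hb, hτ]
    ring
  have s2 : partialNegOne (partialOne (partialOne τ)) x y =
      τ x y * (b (-1) 2 x y + b 0 1 x y) := by
    rw [partialNegOne_eq_of_det_ne_zero hp0 hs t2 hdet (d 0 2)]
    norm_num only
    rw [bracket_self hc 0, bracket_skew hc 0 (-1), hb, hτ]
    ring
  have d3 := (d 1 2).fun_add (d 0 3)
  have s3 : partialNegOne (partialOne (partialOne (partialOne τ))) x y =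
      τ x y * (b 0 2 x y + b 0 1 x y * b (-1) 2 x y - b (-1) 1 x y * b 0 2 x y +
        b (-1) 0 x y * b 1 2 x y + b (-1) 3 x y + b 0 2 x y) := by
    have t3' : ∀ x y, (entryMatrix p c ξ₀ x y).det ≠ 0 →
        partialOne (partialOne (partialOne τ)) x y = τ x y * b 1 2 x y + τ x y * b 0 3 x y :=
      fun x y h => by rw [t3 x y h, mul_add]
    rw [partialNegOne_eq_of_det_ne_zero hp0 hs t3' hdet d3]
    norm_num only
    rw [bracket_self hc 0, bracket_self hc 1, bracket_skew hc 0 (-1), bracket_skew hc 1 0,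
      bracket_skew hc 1 (-1), hb, hτ]
    ring
  have r0 : ∀ x y, (entryMatrix p c ξ₀ x y).det ≠ 0 → τ x y * b 0 3 x y =
      2 * (τ x y * b 1 2 x y) := fun x y h => by
    rw [hb, bracket_zero_three hs hc hp h]; ring
  -- The `x_{-1}`-derivative of the reduction relation `r0`.
  have r1 : τ x y * (b (-1) 3 x y + b 0 2 x y) =
      2 * (τ x y * (b 0 2 x y + b 0 1 x y * b (-1) 2 x y - b (-1) 1 x y * b 0 2 x y +
        b (-1) 0 x y * b 1 2 x y)) := by
    have h1 := partialNegOne_eq_of_det_ne_zero hp0 hs r0 hdet ((d 1 2).const_mul 2)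
    have h2 := (d 0 3).deriv.symm.trans h1
    norm_num only at h2
    rw [bracket_self hc 0, bracket_self hc 1, bracket_skew hc 0 (-1), bracket_skew hc 1 0,
      bracket_skew hc 1 (-1)] at h2
    rw [hb, hτ]
    linear_combination h2
  unfold bilinearForm
  rw [t1 x y hdet, t2 x y hdet, t3 x y hdet, s0, s1, s2, s3]
  have r0' := r0 x y hdet
  linear_combination τ x y * r1 - τ x y * b (-1) 0 x y * r0'

/-- If the form were nonzero at a point, it would be nonzero nearby, forcing `det = 0` and hence `τ
= 0` on a neighbourhood. Every term of the form has a factor `τ` or a pure `x_1`-derivative of `τ`,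
so the form would vanish after all. -/
lemma bilinearForm_tau (hp0 : ∀ i, p i ≠ 0) (hs : ∀ i j, p i + p j ≠ 0)
    (hc : ∀ i, c i = -c (Fin.rev i))
    (hp : ∀ i, p i ^ 2 - p i * p (Fin.rev i) + p (Fin.rev i) ^ 2 = 0) (x y : ℝ) :
    bilinearForm (tau p c ξ₀) x y = 0 := by
  have hf := contDiff_tau p c ξ₀
  set τ := tau p c ξ₀ with hτ
  have c1 := contDiff_partialOne hf
  have c2 := contDiff_partialOne c1
  have c3 := contDiff_partialOne c2
  have hcont : Continuous fun z : ℝ × ℝ => bilinearForm τ z.1 z.2 := by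
    have := hf.continuous
    have := c1.continuous
    have := c2.continuous
    have := c3.continuous
    have := (contDiff_partialNegOne hf).continuous
    have := (contDiff_partialNegOne c1).continuous
    have := (contDiff_partialNegOne c2).continuous
    have := (contDiff_partialNegOne c3).continuous
    unfold bilinearForm
    fun_prop
  by_contra hne
  have hev : ∀ᶠ w in nhds (x, y), bilinearForm τ w.1 w.2 ≠ 0 :=
    hcont.continuousAt.eventually_ne hne
  have z0 : ∀ᶠ w in nhds (x, y), τ w.1 w.2 = 0 := hev.mono fun w hw => by
    by_contra hτw
    refine hw (bilinearForm_tau_of_det_ne_zero hp0 hs hc hp fun hdet => hτw ?_)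
    exact pf_eq_zero_of_det_eq_zero (transpose_entryMatrix hc) hdet
  have z1 := eventually_partialOne_eq_zero z0
  have z2 := eventually_partialOne_eq_zero z1
  have z3 := eventually_partialOne_eq_zero z2
  apply hne
  unfold bilinearForm
  rw [z0.self_of_nhds, z1.self_of_nhds, z2.self_of_nhds, z3.self_of_nhds]
  ring

end

end BKPSoliton

theorem mainTheorem6 (N : ℕ) (p c ξ₀ : Fin (2 * N) → ℂ)
    (hp0 : ∀ i, p i ≠ 0)
    (hpp : ∀ i j, i ≠ j → p i + p j ≠ 0)
    (hc : ∀ i, c i = -c (Fin.rev i))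
    (hp : ∀ i, p i ^ 2 - p i * p (Fin.rev i) + p (Fin.rev i) ^ 2 = 0) :
    ContDiff ℝ ∞ (fun z : ℝ × ℝ => BKPSoliton.tau p c ξ₀ z.1 z.2) ∧
      ∀ x y : ℝ,
        BKPSoliton.hirota 1 3 (BKPSoliton.tau p c ξ₀) (BKPSoliton.tau p c ξ₀) x y -
          3 * BKPSoliton.hirota 0 2 (BKPSoliton.tau p c ξ₀) (BKPSoliton.tau p c ξ₀) x y = 0 := by
  have hf := BKPSoliton.contDiff_tau p c ξ₀
  refine ⟨hf, fun x y => ?_⟩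
  have h := BKPSoliton.bilinearForm_tau (ξ₀ := ξ₀) hp0
    (BKPSoliton.add_ne_zero_of_ne hp0 hpp) hc hp x y
  rw [BKPSoliton.bilinearForm] at h
  rw [BKPSoliton.hirota_one_three hf, BKPSoliton.hirota_zero_two hf]
  linear_combination 2 * h
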